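/- Let $z_1, z_2$ be nonzero complex numbers and let $$P(u)=\overline{z_1}\,\overline{z_2}\,u^4-(\overline{z_1}+\overline{z_2})\,u^3+(z_1+z_2)\,u-z_1z_2 .$$ Call a zero of $P$ unimodular if it has modulus $1$, and simple if it has multiplicity $1$. Then: (a) if $|z_1+z_2|<|z_1z_2|$, then $P$ has four simple unimodular zeros; (b) if $|z_1+z_2|>2|z_1z_2|$, then $P$ has exactly two distinct unimodular zeros, and both are simple; (c) if $P$ has four simple unimodular zeros, then $|z_1+z_2|<2|z_1z_2|$; (d) if $P$ has exactly two distinct unimodular zeros, and both are simple, then $|z_1+z_2|>|z_1z_2|$. -/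

import Mathlib

open Polynomial

/-- The polynomial `P(u) = conj z₁ * conj z₂ * u^4 - (conj z₁ + conj z₂) * u^3
+ (z₁ + z₂) * u - z₁ * z₂`. -/
noncomputable def alhazenQuartic (z₁ z₂ : ℂ) : ℂ[X] :=
  C (star z₁ * star z₂) * X ^ 4 - C (star z₁ + star z₂) * X ^ 3
    + C (z₁ + z₂) * X - C (z₁ * z₂)

/-- The set of zeros of `P` on the unit circle. -/
def unimodularZeros (P : ℂ[X]) : Set ℂ := {u | ‖u‖ = 1 ∧ P.IsRoot u}

/-- The zero `u` of `P` is simple, that is, has multiplicity one. -/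
def IsSimpleZero (P : ℂ[X]) (u : ℂ) : Prop := P.rootMultiplicity u = 1

/-- `P` has four (distinct) zeros that are unimodular and simple. -/
def HasFourSimpleUnimodularZeros (P : ℂ[X]) : Prop :=
  {u ∈ unimodularZeros P | IsSimpleZero P u}.ncard = 4

/-- `P` has exactly two unimodular zeros, and both of them are simple. -/
def HasExactlyTwoUnimodularZerosSimple (P : ℂ[X]) : Prop :=
  (unimodularZeros P).ncard = 2 ∧ ∀ u ∈ unimodularZeros P, IsSimpleZero P u

/-! Write `a = z₁ * z₂` and `s = z₁ + z₂`. On the circle, `P(u) / u ^ 2` is `2i` times a real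
trigonometric function, `circleForm`, with an amplitude `‖a‖` term of frequency two and an amplitude
`‖s‖` term of frequency one. The dominant term fixes the signs, so the intermediate value theorem
gives four zeros if `‖s‖ < ‖a‖` and two if `‖a‖ < ‖s‖`. The upper bounds come from Vieta
(`vieta_alhazenQuartic`): `P` has no `u ^ 2` term, so the square of the sum of the roots is the sum
of their squares, and `norm_add_sq_eq` follows. Three unimodular roots force the fourth to be
unimodular, hence `‖s‖ ≤ 2 * ‖a‖`, strictly if those three are distinct. This settles (b) and (c).
For (d), the case `‖s‖ < ‖a‖` is excluded by (a), and if `‖s‖ = ‖a‖` an explicit factorization gives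
three unimodular zeros. -/

/-! ### Trigonometric form on the unit circle -/

open Complex in
/-- The real trigonometric polynomial to which the quartic reduces on the unit circle. -/
noncomputable def circleForm (a s : ℂ) (θ : ℝ) : ℝ :=
  ‖a‖ * Real.sin (2 * θ - a.arg) - ‖s‖ * Real.sin (θ - s.arg)

theorem continuous_circleForm (a s : ℂ) : Continuous (circleForm a s) := by
  unfold circleForm
  fun_prop

theorem eval_alhazenQuartic (z₁ z₂ u : ℂ) : (alhazenQuartic z₁ z₂).eval u =
    star (z₁ * z₂) * u ^ 4 - star (z₁ + z₂) * u ^ 3 + (z₁ + z₂) * u - z₁ * z₂ := by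
  simp [alhazenQuartic]

-- The left side is a number minus its conjugate, hence `2i` times an imaginary part, read off from
-- the polar form of `w`.
open Complex in
theorem conj_mul_sub_mul_conj_eq_sin (w : ℂ) (x : ℝ) :
    star w * exp (x * I) - w * exp (-(x * I)) =
      2 * I * ((‖w‖ * Real.sin (x - w.arg) : ℝ) : ℂ) := by
  have hs : star w = ‖w‖ * exp (-(w.arg * I)) := by
    conv_lhs => rw [← norm_mul_exp_arg_mul_I w]
    rw [Complex.star_def, map_mul, conj_ofReal, ← exp_conj, map_mul, conj_I, conj_ofReal, mul_neg]
  rw [hs]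
  conv_lhs => enter [2, 1]; rw [← norm_mul_exp_arg_mul_I w]
  rw [mul_assoc, mul_assoc, ← exp_add, ← exp_add]
  push_cast
  rw [Complex.sin]
  have h1 : -(((x : ℂ) - w.arg) * I) = w.arg * I + -(x * I) := by ring
  have h2 : ((x : ℂ) - w.arg) * I = -(w.arg * I) + x * I := by ring
  rw [neg_mul, h1, h2]
  linear_combination (‖w‖ * (exp (-(w.arg * I) + x * I) - exp (w.arg * I + -(x * I)))) * I_sq

open Complex in
theorem eval_alhazenQuartic_exp (z₁ z₂ : ℂ) (θ : ℝ) :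
    (alhazenQuartic z₁ z₂).eval (exp (θ * I)) =
      exp (θ * I) ^ 2 * (2 * I * (circleForm (z₁ * z₂) (z₁ + z₂) θ : ℂ)) := by
  have ha := conj_mul_sub_mul_conj_eq_sin (z₁ * z₂) (2 * θ)
  have hs := conj_mul_sub_mul_conj_eq_sin (z₁ + z₂) θ
  rw [eval_alhazenQuartic, circleForm, ofReal_sub, mul_sub, ← ha, ← hs]
  have h2 : exp (((2 * θ : ℝ) : ℂ) * I) = exp (θ * I) ^ 2 := by
    rw [← exp_nat_mul]; push_cast; ring_nf
  rw [exp_neg, exp_neg, h2]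
  have h0 := exp_ne_zero (θ * I)
  field_simp
  ring

open Complex in
theorem exp_mem_unimodularZeros {z₁ z₂ : ℂ} {θ : ℝ}
    (h : circleForm (z₁ * z₂) (z₁ + z₂) θ = 0) :
    exp (θ * I) ∈ unimodularZeros (alhazenQuartic z₁ z₂) :=
  ⟨norm_exp_ofReal_mul_I θ, by rw [IsRoot, eval_alhazenQuartic_exp, h]; simp⟩

open Complex in
theorem exp_mul_I_ne_of_lt {x y : ℝ} (h : x < y) (h' : y < x + 2 * Real.pi) :
    exp (x * I) ≠ exp (y * I) := by
  intro he
  obtain ⟨n, hn⟩ := exp_eq_exp_iff_exists_int.1 he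
  have h1 : x = y + n * (2 * Real.pi) := by
    have := congrArg Complex.im hn
    simpa using this
  have hp := Real.pi_pos
  have h2 : n < 0 := by
    by_contra! hc
    have : (0 : ℝ) ≤ n := by exact_mod_cast hc
    nlinarith
  have h3 : -1 < n := by
    by_contra! hc
    have : (n : ℝ) ≤ -1 := by exact_mod_cast hc
    nlinarith
  omega

theorem exists_zero_of_neg_pos {f : ℝ → ℝ} (hf : Continuous f) {x y : ℝ} (hxy : x ≤ y)
    (hx : f x < 0) (hy : 0 < f y) : ∃ t, x < t ∧ t < y ∧ f t = 0 := by
  obtain ⟨t, ht, h⟩ := intermediate_value_Ioo hxy hf.continuousOn ⟨hx, hy⟩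
  exact ⟨t, ht.1, ht.2, h⟩

theorem exists_zero_of_pos_neg {f : ℝ → ℝ} (hf : Continuous f) {x y : ℝ} (hxy : x ≤ y)
    (hx : 0 < f x) (hy : f y < 0) : ∃ t, x < t ∧ t < y ∧ f t = 0 := by
  obtain ⟨t, ht, h⟩ := intermediate_value_Ioo' hxy hf.continuousOn ⟨hy, hx⟩
  exact ⟨t, ht.1, ht.2, h⟩

theorem abs_norm_mul_sin_le (w : ℂ) (x : ℝ) : |‖w‖ * Real.sin x| ≤ ‖w‖ := by
  rw [abs_mul, abs_norm]
  exact mul_le_of_le_one_right (norm_nonneg w) (Real.abs_sin_le_one x)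

theorem circleForm_pos_of_sin_eq_one {a s : ℂ} (h : ‖s‖ < ‖a‖) {θ : ℝ}
    (hθ : Real.sin (2 * θ - a.arg) = 1) : 0 < circleForm a s θ := by
  have := (abs_le.1 (abs_norm_mul_sin_le s (θ - s.arg))).2
  rw [circleForm, hθ]
  linarith

theorem circleForm_neg_of_sin_eq_neg_one {a s : ℂ} (h : ‖s‖ < ‖a‖) {θ : ℝ}
    (hθ : Real.sin (2 * θ - a.arg) = -1) : circleForm a s θ < 0 := by
  have := (abs_le.1 (abs_norm_mul_sin_le s (θ - s.arg))).1
  rw [circleForm, hθ]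
  linarith

/-! ### Zeros from sign changes -/

open Complex in
theorem exists_two_unimodularZeros {z₁ z₂ : ℂ} (h : ‖z₁ * z₂‖ < ‖z₁ + z₂‖) :
    ∃ p ∈ unimodularZeros (alhazenQuartic z₁ z₂), ∃ q ∈ unimodularZeros (alhazenQuartic z₁ z₂),
      p ≠ q := by
  set a := z₁ * z₂ with ha
  set s := z₁ + z₂ with hs
  have hc := continuous_circleForm a s
  have hp := Real.pi_pos
  have b (x : ℝ) := abs_le.1 (abs_norm_mul_sin_le a x)
  -- At `s.arg ± π / 2` the `s` term attains its extreme values and dominates the `a` term.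
  have h0 : 0 < circleForm a s (s.arg - Real.pi / 2) := by
    have := (b (2 * (s.arg - Real.pi / 2) - a.arg)).1
    rw [circleForm, show s.arg - Real.pi / 2 - s.arg = -(Real.pi / 2) by ring, Real.sin_neg,
      Real.sin_pi_div_two]
    linarith
  have h1 : circleForm a s (s.arg + Real.pi / 2) < 0 := by
    have := (b (2 * (s.arg + Real.pi / 2) - a.arg)).2
    rw [circleForm, show s.arg + Real.pi / 2 - s.arg = Real.pi / 2 by ring,
      Real.sin_pi_div_two]
    linarith
  have h2 : 0 < circleForm a s (s.arg - Real.pi / 2 + 2 * Real.pi) := by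
    have := (b (2 * (s.arg - Real.pi / 2 + 2 * Real.pi) - a.arg)).1
    rw [circleForm, show s.arg - Real.pi / 2 + 2 * Real.pi - s.arg
      = -(Real.pi / 2) + 2 * Real.pi by ring, Real.sin_add_two_pi, Real.sin_neg,
      Real.sin_pi_div_two]
    linarith
  obtain ⟨x, hx, hx', hfx⟩ := exists_zero_of_pos_neg hc (by linarith) h0 h1
  obtain ⟨y, hy, hy', hfy⟩ := exists_zero_of_neg_pos hc (by linarith) h1 h2
  exact ⟨_, exp_mem_unimodularZeros hfx, _, exp_mem_unimodularZeros hfy,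
    exp_mul_I_ne_of_lt (by linarith) (by linarith)⟩

open Complex in
theorem exists_four_unimodularZeros {z₁ z₂ : ℂ} (h : ‖z₁ + z₂‖ < ‖z₁ * z₂‖) :
    ∃ p q r t : ℂ, p ∈ unimodularZeros (alhazenQuartic z₁ z₂) ∧
      q ∈ unimodularZeros (alhazenQuartic z₁ z₂) ∧ r ∈ unimodularZeros (alhazenQuartic z₁ z₂) ∧
      t ∈ unimodularZeros (alhazenQuartic z₁ z₂) ∧ [p, q, r, t].Nodup := by
  set a := z₁ * z₂ with ha
  set s := z₁ + z₂ with hs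
  have hc := continuous_circleForm a s
  have hp := Real.pi_pos
  -- Chosen so that `2 * c - a.arg = π / 2`; each shift by `π / 2` then flips the sign of the
  -- dominant sine.
  set c := a.arg / 2 + Real.pi / 4 with hcdef
  have h0 : 0 < circleForm a s c := circleForm_pos_of_sin_eq_one h (by
    rw [show 2 * c - a.arg = Real.pi / 2 by ring, Real.sin_pi_div_two])
  have h1 : circleForm a s (c + Real.pi / 2) < 0 := circleForm_neg_of_sin_eq_neg_one h (by
    rw [show 2 * (c + Real.pi / 2) - a.arg = Real.pi / 2 + Real.pi by ring, Real.sin_add_pi,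
      Real.sin_pi_div_two])
  have h2 : 0 < circleForm a s (c + Real.pi) := circleForm_pos_of_sin_eq_one h (by
    rw [show 2 * (c + Real.pi) - a.arg = Real.pi / 2 + 2 * Real.pi by ring, Real.sin_add_two_pi,
      Real.sin_pi_div_two])
  have h3 : circleForm a s (c + 3 * Real.pi / 2) < 0 := circleForm_neg_of_sin_eq_neg_one h (by
    rw [show 2 * (c + 3 * Real.pi / 2) - a.arg = Real.pi / 2 + Real.pi + 2 * Real.pi by ring,
      Real.sin_add_two_pi, Real.sin_add_pi, Real.sin_pi_div_two])
  have h4 : 0 < circleForm a s (c + 2 * Real.pi) := circleForm_pos_of_sin_eq_one h (by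
    rw [show 2 * (c + 2 * Real.pi) - a.arg = Real.pi / 2 + 2 * Real.pi + 2 * Real.pi by ring,
      Real.sin_add_two_pi, Real.sin_add_two_pi, Real.sin_pi_div_two])
  obtain ⟨x, hx, hx', hfx⟩ := exists_zero_of_pos_neg hc (by linarith) h0 h1
  obtain ⟨y, hy, hy', hfy⟩ := exists_zero_of_neg_pos hc (by linarith) h1 h2
  obtain ⟨z, hz, hz', hfz⟩ := exists_zero_of_pos_neg hc (by linarith) h2 h3
  obtain ⟨w, hw, hw', hfw⟩ := exists_zero_of_neg_pos hc (by linarith) h3 h4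
  have e1 := exp_mul_I_ne_of_lt (x := x) (y := y) (by linarith) (by linarith)
  have e2 := exp_mul_I_ne_of_lt (x := x) (y := z) (by linarith) (by linarith)
  have e3 := exp_mul_I_ne_of_lt (x := x) (y := w) (by linarith) (by linarith)
  have e4 := exp_mul_I_ne_of_lt (x := y) (y := z) (by linarith) (by linarith)
  have e5 := exp_mul_I_ne_of_lt (x := y) (y := w) (by linarith) (by linarith)
  have e6 := exp_mul_I_ne_of_lt (x := z) (y := w) (by linarith) (by linarith)
  refine ⟨_, _, _, _, exp_mem_unimodularZeros hfx, exp_mem_unimodularZeros hfy,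
    exp_mem_unimodularZeros hfz, exp_mem_unimodularZeros hfw, ?_⟩
  simp [e1, e2, e3, e4, e5, e6]

/-! ### Roots, Vieta relations and norm bounds -/

section Factorization

variable {z₁ z₂ : ℂ}

theorem natDegree_alhazenQuartic (h : z₁ * z₂ ≠ 0) : (alhazenQuartic z₁ z₂).natDegree = 4 := by
  unfold alhazenQuartic
  compute_degree
  · simpa using h
  all_goals norm_num

theorem leadingCoeff_alhazenQuartic (h : z₁ * z₂ ≠ 0) :
    (alhazenQuartic z₁ z₂).leadingCoeff = star (z₁ * z₂) := by
  rw [leadingCoeff, natDegree_alhazenQuartic h]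
  rw [alhazenQuartic, coeff_sub, coeff_add, coeff_sub, coeff_C_mul_X_pow, coeff_C_mul_X_pow,
    coeff_C_mul, coeff_X, coeff_C]
  simp

theorem alhazenQuartic_ne_zero (h : z₁ * z₂ ≠ 0) : alhazenQuartic z₁ z₂ ≠ 0 := by
  intro h0
  simpa [h0] using natDegree_alhazenQuartic h

theorem card_roots_alhazenQuartic (h : z₁ * z₂ ≠ 0) : (alhazenQuartic z₁ z₂).roots.card = 4 := by
  rw [← natDegree_alhazenQuartic h]
  exact (IsAlgClosed.splits _).natDegree_eq_card_roots.symm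

theorem mem_roots_of_mem_unimodularZeros (h : z₁ * z₂ ≠ 0) {u : ℂ}
    (hu : u ∈ unimodularZeros (alhazenQuartic z₁ z₂)) : u ∈ (alhazenQuartic z₁ z₂).roots :=
  (mem_roots (alhazenQuartic_ne_zero h)).2 hu.2

theorem eval_alhazenQuartic_eq_of_roots (h : z₁ * z₂ ≠ 0) {p q r t : ℂ}
    (hr : (alhazenQuartic z₁ z₂).roots = {p, q, r, t}) (u : ℂ) :
    (alhazenQuartic z₁ z₂).eval u =
      star (z₁ * z₂) * ((u - p) * (u - q) * (u - r) * (u - t)) := by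
  have := (IsAlgClosed.splits (alhazenQuartic z₁ z₂)).eq_prod_roots
  rw [this, leadingCoeff_alhazenQuartic h, hr]
  simp [mul_assoc]

theorem vieta_alhazenQuartic (h : z₁ * z₂ ≠ 0) {p q r t : ℂ}
    (hr : (alhazenQuartic z₁ z₂).roots = {p, q, r, t}) :
    star (z₁ * z₂) * (p * q * r * t) = -(z₁ * z₂) ∧
    star (z₁ + z₂) = star (z₁ * z₂) * (p + q + r + t) ∧
    p * q + p * r + p * t + q * r + q * t + r * t = 0 := by
  have key := eval_alhazenQuartic_eq_of_roots h hr
  simp only [eval_alhazenQuartic] at key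
  -- Four sample values suffice to recover the coefficients, since the leading ones already agree.
  have h0 := key 0
  have h1 := key 1
  have h2 := key (-1)
  have h3 := key 2
  have ha : star (z₁ * z₂) ≠ 0 := by simpa using h
  have e2 : star (z₁ * z₂) * (p * q + p * r + p * t + q * r + q * t + r * t) = 0 := by
    linear_combination h0 - h1 / 2 - h2 / 2
  refine ⟨by linear_combination -h0, ?_, (mul_eq_zero.1 e2).resolve_left ha⟩
  linear_combination (h0 + h1 - h2 - h3) / 6 - 2 / 3 * e2

/-- The product of the four roots is `-a / star a`, of modulus one. -/
theorem norm_fourth_root (h : z₁ * z₂ ≠ 0) {p q r t : ℂ}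
    (hr : (alhazenQuartic z₁ z₂).roots = {p, q, r, t})
    (hp : ‖p‖ = 1) (hq : ‖q‖ = 1) (hr' : ‖r‖ = 1) : ‖t‖ = 1 := by
  have := congrArg norm (vieta_alhazenQuartic h hr).1
  rw [norm_mul, norm_star, norm_neg] at this
  have := mul_left_cancel₀ (norm_ne_zero_iff.2 h) (this.trans (mul_one _).symm)
  simpa [hp, hq, hr'] using this

theorem norm_add_sq_eq (h : z₁ * z₂ ≠ 0) {p q r t : ℂ}
    (hr : (alhazenQuartic z₁ z₂).roots = {p, q, r, t}) :
    ‖z₁ + z₂‖ ^ 2 = ‖z₁ * z₂‖ ^ 2 * ‖p ^ 2 + q ^ 2 + r ^ 2 + t ^ 2‖ := by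
  obtain ⟨-, h1, h2⟩ := vieta_alhazenQuartic h hr
  have : star (z₁ + z₂) ^ 2 = star (z₁ * z₂) ^ 2 * (p ^ 2 + q ^ 2 + r ^ 2 + t ^ 2) := by
    rw [h1]
    linear_combination 2 * star (z₁ * z₂) ^ 2 * h2
  have := congrArg norm this
  rwa [norm_mul, norm_pow, norm_pow, norm_star, norm_star] at this

theorem norm_add_four_sq_le {p q r t : ℂ} (hp : ‖p‖ = 1) (hq : ‖q‖ = 1) (hr : ‖r‖ = 1)
    (ht : ‖t‖ = 1) : ‖p ^ 2 + q ^ 2 + r ^ 2 + t ^ 2‖ ≤ 4 := by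
  refine norm_add₄_le.trans ?_
  simp only [norm_pow, hp, hq, hr, ht]
  norm_num

theorem norm_add_sq_lt_two {p q : ℂ} (hp : ‖p‖ = 1) (hq : ‖q‖ = 1) (h : p ^ 2 ≠ q ^ 2) :
    ‖p ^ 2 + q ^ 2‖ < 2 := by
  have hpq : ‖p ^ 2‖ = ‖q ^ 2‖ := by simp [hp, hq]
  have := norm_add_lt_of_not_sameRay (x := p ^ 2) (y := q ^ 2)
    (fun hs => h ((sameRay_iff_of_norm_eq hpq).1 hs))
  simp only [norm_pow, hp, hq] at this
  linarith

/-- A number has at most two square roots, so the squares of three distinct numbers are not all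
equal; two different unimodular squares make the triangle inequality strict. -/
theorem norm_add_four_sq_lt {p q r t : ℂ} (hp : ‖p‖ = 1) (hq : ‖q‖ = 1) (hr : ‖r‖ = 1)
    (ht : ‖t‖ = 1) (hpq : p ≠ q) (hpr : p ≠ r) (hqr : q ≠ r) :
    ‖p ^ 2 + q ^ 2 + r ^ 2 + t ^ 2‖ < 4 := by
  have hr2 : ‖r ^ 2‖ = 1 := by simp [hr]
  have hq2 : ‖q ^ 2‖ = 1 := by simp [hq]
  have ht2 : ‖t ^ 2‖ = 1 := by simp [ht]
  by_cases h : p ^ 2 = q ^ 2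
  · have hq' : p = -q := (sq_eq_sq_iff_eq_or_eq_neg.1 h).resolve_left hpq
    have h' : p ^ 2 ≠ r ^ 2 := fun h' => hqr (neg_injective
      (hq'.symm.trans ((sq_eq_sq_iff_eq_or_eq_neg.1 h').resolve_left hpr)))
    have h1 := norm_add_sq_lt_two hp hr h'
    have h2 := norm_add₃_le (a := p ^ 2 + r ^ 2) (b := q ^ 2) (c := t ^ 2)
    rw [show p ^ 2 + q ^ 2 + r ^ 2 + t ^ 2 = p ^ 2 + r ^ 2 + q ^ 2 + t ^ 2 by ring]
    linarith
  · have h1 := norm_add_sq_lt_two hp hq h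
    have h2 := norm_add₃_le (a := p ^ 2 + q ^ 2) (b := r ^ 2) (c := t ^ 2)
    linarith

/-- If three zeros, counted with multiplicity, are unimodular, then the ratio of the norms of
`z₁ + z₂` and `z₁ * z₂` is at most two. -/
theorem norm_add_le_of_three_unimodular (h : z₁ * z₂ ≠ 0) {p q r t : ℂ}
    (hr : (alhazenQuartic z₁ z₂).roots = {p, q, r, t})
    (hp : ‖p‖ = 1) (hq : ‖q‖ = 1) (hr' : ‖r‖ = 1) : ‖z₁ + z₂‖ ≤ 2 * ‖z₁ * z₂‖ := by
  have h4 := norm_add_four_sq_le hp hq hr' (norm_fourth_root h hr hp hq hr')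
  refine (pow_le_pow_iff_left₀ (norm_nonneg _) (by positivity) two_ne_zero).1 ?_
  rw [norm_add_sq_eq h hr, mul_pow]
  nlinarith [sq_nonneg ‖z₁ * z₂‖]

theorem norm_add_lt_of_three_unimodular (h : z₁ * z₂ ≠ 0) {p q r t : ℂ}
    (hr : (alhazenQuartic z₁ z₂).roots = {p, q, r, t})
    (hp : ‖p‖ = 1) (hq : ‖q‖ = 1) (hr' : ‖r‖ = 1) (hpq : p ≠ q) (hpr : p ≠ r) (hqr : q ≠ r) :
    ‖z₁ + z₂‖ < 2 * ‖z₁ * z₂‖ := by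
  have h4 := norm_add_four_sq_lt hp hq hr' (norm_fourth_root h hr hp hq hr') hpq hpr hqr
  refine lt_of_pow_lt_pow_left₀ 2 (by positivity) ?_
  have := norm_pos_iff.2 h
  rw [norm_add_sq_eq h hr, mul_pow]
  nlinarith [pow_pos this 2]

theorem roots_eq_of_nodup (h : z₁ * z₂ ≠ 0) {p q r t : ℂ}
    (hp : p ∈ (alhazenQuartic z₁ z₂).roots) (hq : q ∈ (alhazenQuartic z₁ z₂).roots)
    (hr : r ∈ (alhazenQuartic z₁ z₂).roots) (ht : t ∈ (alhazenQuartic z₁ z₂).roots)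
    (hn : [p, q, r, t].Nodup) : (alhazenQuartic z₁ z₂).roots = {p, q, r, t} := by
  refine (Multiset.eq_of_le_of_card_le ((Multiset.le_iff_subset ?_).2 ?_) ?_).symm
  · exact Multiset.coe_nodup.2 hn
  · intro x hx
    simp only [Multiset.insert_eq_cons, Multiset.mem_cons, Multiset.mem_singleton] at hx
    rcases hx with rfl | rfl | rfl | rfl <;> assumption
  · rw [card_roots_alhazenQuartic h]
    simp

theorem exists_roots_eq_of_ne (h : z₁ * z₂ ≠ 0) {p q : ℂ}
    (hp : p ∈ (alhazenQuartic z₁ z₂).roots) (hq : q ∈ (alhazenQuartic z₁ z₂).roots)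
    (hpq : p ≠ q) : ∃ r t, (alhazenQuartic z₁ z₂).roots = {p, q, r, t} := by
  obtain ⟨m, hm⟩ := Multiset.exists_cons_of_mem hp
  have hq' : q ∈ m := by
    rw [hm, Multiset.mem_cons] at hq
    exact hq.resolve_left hpq.symm
  obtain ⟨m', rfl⟩ := Multiset.exists_cons_of_mem hq'
  have hc := card_roots_alhazenQuartic h
  rw [hm, Multiset.card_cons, Multiset.card_cons] at hc
  obtain ⟨r, t, rfl⟩ := Multiset.card_eq_two.1 (show m'.card = 2 by omega)
  exact ⟨r, t, hm⟩

/-! ### The four implications -/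

theorem hasFourSimpleUnimodularZeros_of_norm_add_lt (h : z₁ * z₂ ≠ 0)
    (hlt : ‖z₁ + z₂‖ < ‖z₁ * z₂‖) : HasFourSimpleUnimodularZeros (alhazenQuartic z₁ z₂) := by
  obtain ⟨p, q, r, t, hp, hq, hr, ht, hn⟩ := exists_four_unimodularZeros hlt
  have hroots := roots_eq_of_nodup h (mem_roots_of_mem_unimodularZeros h hp)
    (mem_roots_of_mem_unimodularZeros h hq) (mem_roots_of_mem_unimodularZeros h hr)
    (mem_roots_of_mem_unimodularZeros h ht) hn
  have hnd : (alhazenQuartic z₁ z₂).roots.Nodup := hroots ▸ Multiset.coe_nodup.2 hn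
  have hset : {u ∈ unimodularZeros (alhazenQuartic z₁ z₂) | IsSimpleZero (alhazenQuartic z₁ z₂) u}
      = ((alhazenQuartic z₁ z₂).roots.toFinset : Set ℂ) := by
    ext u
    constructor
    · rintro ⟨hu, -⟩
      simpa only [Finset.mem_coe, Multiset.mem_toFinset] using
        mem_roots_of_mem_unimodularZeros h hu
    · intro hu
      rw [Finset.mem_coe, Multiset.mem_toFinset] at hu
      refine ⟨?_, by rw [IsSimpleZero, ← count_roots]; exact Multiset.count_eq_one_of_mem hnd hu⟩
      rw [hroots] at hu
      simp only [Multiset.insert_eq_cons, Multiset.mem_cons, Multiset.mem_singleton] at hu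
      rcases hu with rfl | rfl | rfl | rfl <;> assumption
  rw [HasFourSimpleUnimodularZeros, hset, Set.ncard_coe_finset,
    Multiset.toFinset_card_of_nodup hnd, card_roots_alhazenQuartic h]

theorem hasExactlyTwoUnimodularZerosSimple_of_lt_norm_add (h : z₁ * z₂ ≠ 0)
    (hlt : 2 * ‖z₁ * z₂‖ < ‖z₁ + z₂‖) :
    HasExactlyTwoUnimodularZerosSimple (alhazenQuartic z₁ z₂) := by
  obtain ⟨p, hp, q, hq, hpq⟩ := exists_two_unimodularZeros (z₁ := z₁) (z₂ := z₂)
    (by linarith [norm_nonneg (z₁ * z₂)])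
  obtain ⟨r, t, hroots⟩ := exists_roots_eq_of_ne h (mem_roots_of_mem_unimodularZeros h hp)
    (mem_roots_of_mem_unimodularZeros h hq) hpq
  have hr : ‖r‖ ≠ 1 := fun hr =>
    hlt.not_ge (norm_add_le_of_three_unimodular h hroots hp.1 hq.1 hr)
  have ht : ‖t‖ ≠ 1 := fun ht => hlt.not_ge (norm_add_le_of_three_unimodular h
    (r := t) (t := r) (hroots.trans (by rw [Multiset.pair_comm r])) hp.1 hq.1 ht)
  have hne {u v : ℂ} (hu : ‖u‖ = 1) (hv : ‖v‖ ≠ 1) : u ≠ v := fun huv => hv (huv ▸ hu)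
  have hset : unimodularZeros (alhazenQuartic z₁ z₂) = {p, q} := by
    ext u
    constructor
    · intro hu
      have hm := mem_roots_of_mem_unimodularZeros h hu
      rw [hroots] at hm
      simpa [hne hu.1 hr, hne hu.1 ht] using hm
    · rintro (rfl | rfl) <;> assumption
  refine ⟨by rw [hset, Set.ncard_pair hpq], fun u hu => ?_⟩
  -- The other two roots lie off the circle, so neither can repeat `p` or `q`.
  rw [IsSimpleZero, ← count_roots, hroots]
  have h1 := hne hu.1 hr
  have h2 := hne hu.1 ht
  rw [hset] at hu
  rcases hu with rfl | rfl
  · simp [h1, h2, hpq]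
  · simp [h1, h2, hpq.symm]

theorem norm_add_lt_of_hasFourSimpleUnimodularZeros (h : z₁ * z₂ ≠ 0)
    (hP : HasFourSimpleUnimodularZeros (alhazenQuartic z₁ z₂)) :
    ‖z₁ + z₂‖ < 2 * ‖z₁ * z₂‖ := by
  -- Three distinct unimodular zeros are enough for the strict bound.
  obtain ⟨T, hT, hc⟩ := Set.exists_subset_card_eq (n := 3) (hP.symm ▸ (by norm_num : 3 ≤ 4))
  obtain ⟨p, q, r, hpq, hpr, hqr, rfl⟩ := Set.ncard_eq_three.1 hc
  have hp := (hT (by simp : p ∈ _)).1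
  have hq := (hT (by simp : q ∈ _)).1
  have hr := (hT (by simp : r ∈ _)).1
  obtain ⟨r', t', hroots⟩ := exists_roots_eq_of_ne h (mem_roots_of_mem_unimodularZeros h hp)
    (mem_roots_of_mem_unimodularZeros h hq) hpq
  have hm := mem_roots_of_mem_unimodularZeros h hr
  rw [hroots] at hm
  simp only [Multiset.insert_eq_cons, Multiset.mem_cons, Multiset.mem_singleton, hpr.symm,
    hqr.symm, false_or] at hm
  rcases hm with rfl | rfl
  · exact norm_add_lt_of_three_unimodular h hroots hp.1 hq.1 hr.1 hpq hpr hqr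
  · refine norm_add_lt_of_three_unimodular h (t := r') (hroots.trans ?_) hp.1 hq.1 hr.1 hpq hpr hqr
    rw [Multiset.pair_comm r']

/-- `ncard` is `0` on infinite sets, so comparing cardinalities by inclusion needs finiteness. -/
theorem finite_unimodularZeros (h : z₁ * z₂ ≠ 0) :
    (unimodularZeros (alhazenQuartic z₁ z₂)).Finite :=
  (Multiset.finite_toSet _).subset fun _ hu => mem_roots_of_mem_unimodularZeros h hu

/-- When `‖s‖ = ‖a‖`, `star a * P(u) = (star a * u - star s) * (star a * u ^ 3 + s)`. The cubic
factor has three distinct zeros, the cube roots of `-s / star a`, all unimodular. -/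
theorem three_le_ncard_of_norm_add_eq (h : z₁ * z₂ ≠ 0) (he : ‖z₁ + z₂‖ = ‖z₁ * z₂‖) :
    3 ≤ (unimodularZeros (alhazenQuartic z₁ z₂)).ncard := by
  have ha : star (z₁ * z₂) ≠ 0 := by simpa using h
  have hna : ‖z₁ * z₂‖ ≠ 0 := norm_ne_zero_iff.2 h
  obtain ⟨c, hc⟩ := IsAlgClosed.exists_pow_nat_eq (-(z₁ + z₂) / star (z₁ * z₂)) three_pos
  have hmem {u : ℂ} (hu : u ^ 3 = c ^ 3) : u ∈ unimodularZeros (alhazenQuartic z₁ z₂) := by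
    rw [hc] at hu
    constructor
    · have hn := congrArg norm hu
      rw [norm_pow, norm_div, norm_neg, norm_star, he, div_self hna] at hn
      exact (pow_eq_one_iff_of_nonneg (norm_nonneg u) three_ne_zero).1 hn
    · have h1 : star (z₁ * z₂) * u ^ 3 = -(z₁ + z₂) := by rw [hu, mul_div_cancel₀ _ ha]
      have h2 : star (z₁ + z₂) * (z₁ + z₂) = star (z₁ * z₂) * (z₁ * z₂) := by
        rw [Complex.star_def, Complex.conj_mul', Complex.conj_mul', he]
      rw [IsRoot, eval_alhazenQuartic]
      refine (mul_eq_zero.1 ?_).resolve_left ha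
      linear_combination (star (z₁ * z₂) * u - star (z₁ + z₂)) * h1 + h2
  have hω := Complex.isPrimitiveRoot_exp 3 three_ne_zero
  set ω := Complex.exp (2 * Real.pi * Complex.I / (3 : ℕ))
  have hc0 : c ≠ 0 := by
    rintro rfl
    simpa using (hmem (u := 0) rfl).1
  have hω1 : ω ≠ 1 := hω.ne_one (by norm_num)
  have hω2 : ω ^ 2 ≠ 1 := hω.pow_ne_one_of_pos_of_lt two_ne_zero (by norm_num)
  have hω0 : ω ≠ 0 := hω.ne_zero three_ne_zero
  have h12 : c ≠ c * ω := fun h' => hω1 (mul_left_cancel₀ hc0 (h'.symm.trans (mul_one c).symm))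
  have h13 : c ≠ c * ω ^ 2 :=
    fun h' => hω2 (mul_left_cancel₀ hc0 (h'.symm.trans (mul_one c).symm))
  have h23 : c * ω ≠ c * ω ^ 2 := fun h' => hω1 (mul_left_cancel₀ (mul_ne_zero hc0 hω0)
    (by linear_combination -h'))
  rw [← Set.ncard_eq_three.2 ⟨c, c * ω, c * ω ^ 2, h12, h13, h23, rfl⟩]
  refine Set.ncard_le_ncard ?_ (finite_unimodularZeros h)
  rintro u (rfl | rfl | rfl)
  · exact hmem rfl
  · exact hmem (by rw [mul_pow, hω.pow_eq_one, mul_one])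
  · exact hmem (by rw [mul_pow, pow_right_comm, hω.pow_eq_one, one_pow, mul_one])

theorem lt_norm_add_of_hasExactlyTwoUnimodularZerosSimple (h : z₁ * z₂ ≠ 0)
    (hP : HasExactlyTwoUnimodularZerosSimple (alhazenQuartic z₁ z₂)) :
    ‖z₁ * z₂‖ < ‖z₁ + z₂‖ := by
  by_contra! hle
  have h2 := hP.1
  rcases hle.lt_or_eq with hlt | heq
  · have h4 : _ = 4 := hasFourSimpleUnimodularZeros_of_norm_add_lt h hlt
    have := Set.ncard_le_ncard (Set.sep_subset (unimodularZeros (alhazenQuartic z₁ z₂))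
      (IsSimpleZero (alhazenQuartic z₁ z₂))) (finite_unimodularZeros h)
    omega
  · have := three_le_ncard_of_norm_add_eq h heq
    omega

end Factorization

theorem mainTheorem4 (z₁ z₂ : ℂ) (hz₁ : z₁ ≠ 0) (hz₂ : z₂ ≠ 0) :
    (‖z₁ + z₂‖ < ‖z₁ * z₂‖ → HasFourSimpleUnimodularZeros (alhazenQuartic z₁ z₂)) ∧
    (2 * ‖z₁ * z₂‖ < ‖z₁ + z₂‖ → HasExactlyTwoUnimodularZerosSimple (alhazenQuartic z₁ z₂)) ∧
    (HasFourSimpleUnimodularZeros (alhazenQuartic z₁ z₂) → ‖z₁ + z₂‖ < 2 * ‖z₁ * z₂‖) ∧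
    (HasExactlyTwoUnimodularZerosSimple (alhazenQuartic z₁ z₂) → ‖z₁ * z₂‖ < ‖z₁ + z₂‖) := by
  have h := mul_ne_zero hz₁ hz₂
  exact ⟨hasFourSimpleUnimodularZeros_of_norm_add_lt h,
    hasExactlyTwoUnimodularZerosSimple_of_lt_norm_add h,
    norm_add_lt_of_hasFourSimpleUnimodularZeros h,
    lt_norm_add_of_hasExactlyTwoUnimodularZerosSimple h⟩
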